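/- Consider the infinite square lattice $\mathbb{Z}^2$ as a planar graph whose faces are the unit squares, with one face $h$ (the hole) removed. The distance of two faces is the minimal number of edges that must be crossed to get from one to the other. A configuration assigns an integer $c(F)$ to every face $F$, including the hole (this is the face representation of a conservative flow; the flow on the edge separating $F$ and $G$ is $c(F)-c(G)$). A firing step chooses two faces $F,G$ sharing an edge and acts as follows. If neither is the hole and $c(F)-c(G)\ge 2$, then $c(F)$ decreases by $1$ and $c(G)$ increases by $1$. If $F=h$ and $c(h)-c(G)\ge 1$, then $c(G)$ increases by $1$; if $G=h$ and $c(F)-c(h)\ge 1$, then $c(F)$ decreases by $1$; the value at the hole never changes. A configuration is stable if no firing step is possible. An initial configuration exhibits global confluence if every firing sequence starting from it is finite and there is exactly one stable configuration that can be reached from it. Let $r\ge 1$ be an integer and let $f$ be an integer. The pulse of radius $r$ and force $f$ is the configuration with $c(F)=f$ for every face $F$ at distance at most $r$ from $h$ (including $h$ itself) and $c(F)=0$ for every other face. Then the pulse of radius $r$ and force $f$ exhibits global confluence if and only if $|f|\le 1$ or $r\le 1$. -/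

import Mathlib

namespace FlowFiring

/-- A conservative flow configuration in face representation: an integer (the clockwise flow) on
every face.  The removed face also carries a value. -/
abbrev Config (V : Type*) := V → ℤ

section Firing

variable {V : Type*} [DecidableEq V]

/-- The number of faces that are actually present (not removed) on the two sides of the edge
separating the faces `F` and `G`, when the face `hole` is removed. -/
def edgeDegree (hole F G : V) : ℤ :=
  (if F = hole then 0 else 1) + (if G = hole then 0 else 1)

/-- The result of firing the edge between `F` and `G`, across which the flow is directed from `F`
to `G`: one unit of flow on this edge is rerouted around each of the present faces containing it.
In face representation the value of `F` drops by one and the value of `G` grows by one, except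
that the value of the removed face never changes. -/
def fire (hole F G : V) (c : Config V) : Config V := fun X =>
  if X = hole then c X
  else if X = F then c X - 1
  else if X = G then c X + 1
  else c X

/-- One step of the flow-firing process.  `D` is the dual graph of the planar graph: its vertices
are the faces, and two faces are adjacent when they share an edge.  The flow on the edge
separating `F` and `G` is the difference `c F - c G`; the edge can fire when the amount of flow on
it is at least the number of present faces containing it, so at least `2` for an edge not
on the hole and at least `1` for an edge on the boundary of the hole. -/
def Step (D : SimpleGraph V) (hole : V) (c c' : Config V) : Prop :=
  ∃ F G : V, D.Adj F G ∧ edgeDegree hole F G ≤ c F - c G ∧ c' = fire hole F G c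

/-- A configuration is stable (terminal) if no edge can fire. -/
def Stable (D : SimpleGraph V) (hole : V) (c : Config V) : Prop :=
  ∀ c' : Config V, ¬ Step D hole c c'

/-- `c'` can be obtained from `c` by finitely many (possibly zero) firings. -/
def Reachable (D : SimpleGraph V) (hole : V) (c c' : Config V) : Prop :=
  Relation.ReflTransGen (Step D hole) c c'

/-- Every firing sequence starting from `c` is finite. -/
def Terminates (D : SimpleGraph V) (hole : V) (c : Config V) : Prop :=
  ¬ ∃ s : ℕ → Config V, s 0 = c ∧ ∀ n, Step D hole (s n) (s (n + 1))

/-- Global confluence of an initial configuration: the process started from `c` must terminate,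
and there is exactly one stable configuration at which it can terminate. -/
def GloballyConfluent (D : SimpleGraph V) (hole : V) (c : Config V) : Prop :=
  Terminates D hole c ∧ ∃! s : Config V, Reachable D hole c s ∧ Stable D hole s

/-- The pulse of radius `r` and force `f`: flow `f` through all faces at distance at most `r` from
the hole (the hole included), and flow `0` through all other faces.  The distance of two faces is
the minimal number of edges to be crossed to get from one to the other. -/
noncomputable def pulse (D : SimpleGraph V) (hole : V) (r : ℕ) (f : ℤ) : Config V := fun X =>
  if D.dist hole X ≤ r then f else 0

end Firing

/-- The dual graph of the `ℤ²` lattice: faces are unit squares, labelled by `ℤ × ℤ`, and two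
squares are adjacent when they share an edge. -/
def squareFaces : SimpleGraph (ℤ × ℤ) where
  Adj F G := |F.1 - G.1| + |F.2 - G.2| = 1
  symm := ⟨fun F G h => by rw [abs_sub_comm G.1, abs_sub_comm G.2]; exact h⟩
  loopless := ⟨fun F h => by simp at h⟩

end FlowFiring

namespace FlowFiring

/-! ### Symmetries, termination and monotone bounds on an arbitrary dual graph. -/

section General

variable {V W : Type*} [DecidableEq V] [DecidableEq W]

/-! Translation and a change of sign reduce to the hole at `0` and `f ≥ 0`. If `f ≤ 1` the pulse is
already stable. In all cases the tools are two maximum principles: a 1-Lipschitz function bounding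
the configuration from above or below keeps doing so (`Reachable.le_of_le`, `Reachable.ge_of_ge`).

For `r = 1` the pyramid `max 0 (f + 1 - d)` bounds the process from above, and stability forces the
same bound from below. Hence only one final configuration is possible; a strictly decreasing
quadratic energy on a finite box gives termination.

For `r, f ≥ 2`, suppose there is a unique final configuration `s`. Everything reachable leads to
`s`, so a Lipschitz bound valid at any reachable configuration constrains `s`. Let `D` be the
largest distance at which `s` is positive, and let the corner `X = (D - b, b)` be the lowest such
outermost face in the first quadrant (`Corner`). Block firings into `X` and `Y = (D - b - 1, b +
1)`, and cap their common inner neighbour at `2`; then run to a halt (`Exists` of such a state is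
`Corner.exists_frozen`). The resulting `c` satisfies `c P ≤ D + 1 - d`, and its faces exceeding the
cone bound that would empty `X` lie in row `b` (`Frozen.row_of_lt`). If there are none, `s X ≤ 0`, a
contradiction. Otherwise let `(a, b)` be the leftmost. Sending its unit to `Y` already empties `X`
in `s` if `a + 1 = D - b`. In the remaining case, also sending a unit of `(a + 1, b)` to `X` forces
`s (a + 1, b) ≤ D - b - a - 1`, while sending the unit of `(a, b)` to `X` and one of `(a, b + 1)` to
`Y` forces `s (a + 1, b) ≥ D - b - a`. These two orders are incompatible. -/

theorem fire_neg {hole F G : V} (h : F ≠ G) (c : Config V) :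
    fire hole F G (-c) = -fire hole G F c := by
  funext X
  simp only [fire, Pi.neg_apply]
  split_ifs <;> first | rfl | (subst_vars; exact absurd rfl h) | ring

theorem Step.neg {D : SimpleGraph V} {hole : V} {c c' : Config V} (h : Step D hole c c') :
    Step D hole (-c) (-c') := by
  obtain ⟨F, G, hFG, hd, rfl⟩ := h
  refine ⟨G, F, hFG.symm, ?_, (fire_neg hFG.ne' c).symm⟩
  simp only [edgeDegree, Pi.neg_apply] at *
  linarith

theorem Step.comp {D : SimpleGraph V} {E : SimpleGraph W} {hole : V} {c c' : Config V}
    (h : Step D hole c c') (e : E ≃g D) :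
    Step E (e.symm hole) (c ∘ e) (c' ∘ e) := by
  obtain ⟨F, G, hFG, hd, rfl⟩ := h
  refine ⟨e.symm F, e.symm G, e.symm.map_adj_iff.2 hFG, ?_, ?_⟩
  · simpa [edgeDegree] using hd
  · funext X
    simp [fire, RelIso.eq_symm_apply]

theorem reachable_map {D : SimpleGraph V} {E : SimpleGraph W} {hole : V} {hole' : W}
    {c c' : Config V} (φ : Config V → Config W)
    (h : ∀ x y, Step D hole x y → Step E hole' (φ x) (φ y)) (hc : Reachable D hole c c') :
    Reachable E hole' (φ c) (φ c') := by
  induction hc with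
  | refl => exact .refl
  | tail _ hs ih => exact ih.tail (h _ _ hs)

theorem GloballyConfluent.of_map {D : SimpleGraph V} {E : SimpleGraph W} {hole : V} {hole' : W}
    {c : Config V} {c' : Config W} (φ : Config V ≃ Config W) (hc : φ c = c')
    (h₁ : ∀ x y, Step D hole x y → Step E hole' (φ x) (φ y))
    (h₂ : ∀ x y, Step E hole' x y → Step D hole (φ.symm x) (φ.symm y))
    (h : GloballyConfluent D hole c) : GloballyConfluent E hole' c' := by
  subst hc
  obtain ⟨ht, s, ⟨hs, hst⟩, hu⟩ := h
  refine ⟨?_, φ s, ⟨reachable_map φ h₁ hs, ?_⟩, ?_⟩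
  · rintro ⟨u, hu0, hu⟩
    exact ht ⟨fun n => φ.symm (u n), by simp [hu0], fun n => h₂ _ _ (hu n)⟩
  · intro x hx
    have := h₂ _ _ hx
    rw [Equiv.symm_apply_apply] at this
    exact hst _ this
  · rintro t ⟨ht1, ht2⟩
    rw [← φ.symm_apply_eq]
    refine hu _ ⟨?_, ?_⟩
    · have := reachable_map φ.symm h₂ ht1
      rwa [Equiv.symm_apply_apply] at this
    · intro x hx
      have := h₁ _ _ hx
      rw [Equiv.apply_symm_apply] at this
      exact ht2 _ this

theorem GloballyConfluent.neg {D : SimpleGraph V} {hole : V} {c : Config V}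
    (h : GloballyConfluent D hole c) : GloballyConfluent D hole (-c) :=
  h.of_map (Equiv.neg _) rfl (fun _ _ h => h.neg) (fun _ _ h => h.neg)

theorem GloballyConfluent.comp {D : SimpleGraph V} {E : SimpleGraph W} {hole : V} {c : Config V}
    (h : GloballyConfluent D hole c) (e : E ≃g D) :
    GloballyConfluent E (e.symm hole) (c ∘ e) := by
  refine h.of_map (Equiv.arrowCongr e.symm.toEquiv (Equiv.refl ℤ)) rfl
    (fun _ _ h => h.comp e) (fun x y h => ?_)
  have := h.comp e.symm
  rwa [show e.symm.symm (e.symm hole) = hole from e.apply_symm_apply hole] at this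

theorem GloballyConfluent.of_stable {D : SimpleGraph V} {hole : V} {c : Config V}
    (h : Stable D hole c) : GloballyConfluent D hole c := by
  refine ⟨?_, c, ⟨.refl, h⟩, ?_⟩
  · rintro ⟨u, hu0, hu⟩
    exact h (u 1) (hu0 ▸ hu 0)
  · rintro t ⟨ht, -⟩
    rcases Relation.ReflTransGen.cases_head ht with h' | ⟨x, hx, -⟩
    · exact h'.symm
    · exact absurd hx (h x)

/-- Running only the firings permitted by `p`, keeping the invariant `I`, one ends at a
configuration where no permitted firing is possible. -/
theorem Terminates.exists_restricted {D : SimpleGraph V} {hole : V} {c : Config V}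
    (h : Terminates D hole c) (p : Config V → V → V → Prop) (I : Config V → Prop) (hI : I c)
    (hstep : ∀ x F G, Reachable D hole c x → I x → D.Adj F G → p x F G →
      edgeDegree hole F G ≤ x F - x G → I (fire hole F G x)) :
    ∃ x, Reachable D hole c x ∧ I x ∧
      ∀ F G, D.Adj F G → p x F G → x F - x G < edgeDegree hole F G := by
  by_contra! hcon
  -- If a permitted firing were always available, iterating a choice of it would give an infinite
  -- firing sequence.
  have key : ∀ x : {x // Reachable D hole c x ∧ I x}, ∃ y : {x // Reachable D hole c x ∧ I x},
      Step D hole x.1 y.1 := by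
    rintro ⟨x, hx, hIx⟩
    obtain ⟨F, G, hFG, hp, hd⟩ := hcon x hx hIx
    have hs : Step D hole x (fire hole F G x) := ⟨F, G, hFG, hd, rfl⟩
    exact ⟨⟨_, hx.tail hs, hstep x F G hx hIx hFG hp hd⟩, hs⟩
  choose g hg using key
  refine h ⟨fun n => (g^[n] ⟨c, Relation.ReflTransGen.refl, hI⟩).1, rfl, fun n => ?_⟩
  simp only [Function.iterate_succ_apply']
  exact hg _

theorem Terminates.exists_stable {D : SimpleGraph V} {hole : V} {c : Config V}
    (h : Terminates D hole c) : ∃ s, Reachable D hole c s ∧ Stable D hole s := by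
  obtain ⟨s, hs, -, h'⟩ := h.exists_restricted (fun _ _ _ => True) (fun _ => True) trivial
    (fun _ _ _ _ _ _ _ _ => trivial)
  refine ⟨s, hs, ?_⟩
  rintro c' ⟨F, G, hFG, hd, -⟩
  exact absurd hd (not_le.2 (h' F G hFG trivial))

theorem Terminates.of_reachable {D : SimpleGraph V} {hole : V} {c x : Config V}
    (h : Terminates D hole c) (hx : Reachable D hole c x) : Terminates D hole x := by
  induction hx with
  | refl => exact h
  | @tail y z _ hs ih =>
    rintro ⟨u, hu0, hu⟩
    refine ih ⟨fun n => Nat.casesOn (motive := fun _ => Config V) n y u, rfl, fun n => ?_⟩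
    cases n with
    | zero => simpa [hu0] using hs
    | succ n => exact hu n

/-- From every configuration reachable from a globally confluent one, the final configuration is
still reachable. -/
theorem GloballyConfluent.exists_final {D : SimpleGraph V} {hole : V} {c : Config V}
    (h : GloballyConfluent D hole c) :
    ∃ s, Stable D hole s ∧ (∀ x, Reachable D hole c x → Reachable D hole x s) ∧
      ∀ t, Reachable D hole c t → Stable D hole t → t = s := by
  obtain ⟨ht, s, ⟨hs, hst⟩, hu⟩ := h
  refine ⟨s, hst, fun x hx => ?_, fun t h1 h2 => hu t ⟨h1, h2⟩⟩
  obtain ⟨t, hxt, hts⟩ := (ht.of_reachable hx).exists_stable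
  have : t = s := hu t ⟨hx.trans hxt, hts⟩
  exact this ▸ hxt

variable {D : SimpleGraph V} {hole : V}

theorem Step.hole_eq {c c' : Config V} (h : Step D hole c c') : c' hole = c hole := by
  obtain ⟨F, G, -, -, rfl⟩ := h
  simp [fire]

theorem Reachable.hole_eq {c c' : Config V} (h : Reachable D hole c c') : c' hole = c hole := by
  induction h with
  | refl => rfl
  | tail _ hs ih => rw [hs.hole_eq, ih]

/-- A function that changes by at most one across every edge not on the hole, and is at least
the value of the hole next to it, remains an upper bound. -/
theorem Reachable.le_of_le {c c' : Config V} (h : Reachable D hole c c') (q : V → ℤ)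
    (hq : ∀ F G, D.Adj F G → F ≠ hole → G ≠ hole → q F ≤ q G + 1)
    (hn : ∀ G, D.Adj hole G → c hole ≤ q G) (hc : ∀ X, X ≠ hole → c X ≤ q X) :
    ∀ X, X ≠ hole → c' X ≤ q X := by
  induction h with
  | refl => exact hc
  | @tail x y hx hs ih =>
    have hh := Reachable.hole_eq hx
    obtain ⟨F, G, hFG, hd, rfl⟩ := hs
    intro X hX
    have hXle := ih X hX
    simp only [fire, hX, if_false]
    split_ifs with h1 h2
    · linarith
    · subst h2
      by_cases hF : F = hole
      · subst hF
        have := hn _ hFG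
        simp only [edgeDegree, hX, if_true, if_false] at hd
        linarith
      -- The gap is at least `2`, so the raised value is at most `c F - 1 ≤ q F - 1 ≤ q X`.
      · have h3 := hq F X hFG hF hX
        have h4 := ih F hF
        simp only [edgeDegree, hX, hF, if_false] at hd
        linarith
    · exact hXle

/-- As long as no face exceeds the value of the hole, a function that changes by at most one
across every edge not on the hole remains a lower bound. -/
theorem Reachable.ge_of_ge {c c' : Config V} (h : Reachable D hole c c') (q : V → ℤ)
    (hle : ∀ X, X ≠ hole → c X ≤ c hole)
    (hq : ∀ F G, D.Adj F G → F ≠ hole → G ≠ hole → q F ≤ q G + 1)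
    (hc : ∀ X, X ≠ hole → q X ≤ c X) :
    ∀ X, X ≠ hole → q X ≤ c' X := by
  induction h with
  | refl => exact hc
  | @tail x y hx hs ih =>
    have hh := Reachable.hole_eq hx
    have hle' := Reachable.le_of_le hx (fun _ => c hole) (by intros; simp) (by simp) hle
    obtain ⟨F, G, hFG, hd, rfl⟩ := hs
    intro X hX
    have hXle := ih X hX
    simp only [fire, hX, if_false]
    split_ifs with h1 h2
    · subst h1
      -- No unit can leave through the hole, since that would need a face above the value of the
      -- hole.
      by_cases hG : G = hole
      · subst hG
        have := hle' _ hX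
        simp only [edgeDegree, hX, if_true, if_false] at hd
        linarith
      · have h3 := hq X G hFG hX hG
        have h4 := ih G hG
        simp only [edgeDegree, hX, hG, if_false] at hd
        linarith
    · linarith
    · exact hXle

end General

/-! ### Distances and symmetries of the square lattice. -/

section SquareLattice

/-- The `ℓ¹` distance of two faces of the square lattice. -/
def l1 (P Q : ℤ × ℤ) : ℤ := |P.1 - Q.1| + |P.2 - Q.2|

theorem adj_iff {F G : ℤ × ℤ} : squareFaces.Adj F G ↔ l1 F G = 1 := Iff.rfl

theorem ne_zero_iff {P : ℤ × ℤ} : P ≠ 0 ↔ 0 < l1 0 P := by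
  obtain ⟨x, y⟩ := P
  simp only [l1, ne_eq, Prod.mk_eq_zero, Prod.fst_zero, Prod.snd_zero, abs_eq_max_neg]
  omega

theorem l1_nonneg (P Q : ℤ × ℤ) : 0 ≤ l1 P Q := add_nonneg (abs_nonneg _) (abs_nonneg _)

theorem l1_self (P : ℤ × ℤ) : l1 P P = 0 := by simp [l1]

theorem l1_le_of_adj {F G : ℤ × ℤ} (h : squareFaces.Adj F G) (P : ℤ × ℤ) :
    l1 P F ≤ l1 P G + 1 := by
  rw [adj_iff] at h
  simp only [l1, abs_eq_max_neg] at *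
  omega

theorem exists_adj_l1_eq {P Q : ℤ × ℤ} (h : P ≠ Q) :
    ∃ R, squareFaces.Adj R Q ∧ l1 P R = l1 P Q - 1 := by
  obtain ⟨a, b⟩ := P
  obtain ⟨x, y⟩ := Q
  simp only [adj_iff]
  by_cases h1 : a = x
  · by_cases h2 : b < y
    · exact ⟨(x, y - 1), by simp only [l1, abs_eq_max_neg]; omega,
        by simp only [l1, abs_eq_max_neg]; omega⟩
    · have : y ≠ b := fun h' => h (by rw [h1, h'])
      exact ⟨(x, y + 1), by simp only [l1, abs_eq_max_neg]; omega,
        by simp only [l1, abs_eq_max_neg]; omega⟩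
  · by_cases h2 : a < x
    · exact ⟨(x - 1, y), by simp only [l1, abs_eq_max_neg]; omega,
        by simp only [l1, abs_eq_max_neg]; omega⟩
    · exact ⟨(x + 1, y), by simp only [l1, abs_eq_max_neg]; omega,
        by simp only [l1, abs_eq_max_neg]; omega⟩

theorem l1_le_length {P Q : ℤ × ℤ} (w : squareFaces.Walk P Q) : l1 P Q ≤ w.length := by
  induction w with
  | nil => simp [l1]
  | cons h w ih =>
    rw [adj_iff] at h
    simp only [SimpleGraph.Walk.length_cons, Nat.cast_add, Nat.cast_one]
    simp only [l1, abs_eq_max_neg] at *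
    omega

theorem exists_walk_length_eq (P : ℤ × ℤ) (n : ℕ) :
    ∀ Q, l1 P Q = n → ∃ w : squareFaces.Walk P Q, w.length = n := by
  induction n with
  | zero =>
    intro Q h
    by_cases hPQ : P = Q
    · subst hPQ; exact ⟨.nil, rfl⟩
    · obtain ⟨R, -, hR⟩ := exists_adj_l1_eq hPQ
      have := l1_nonneg P R
      omega
  | succ n ih =>
    intro Q h
    have hPQ : P ≠ Q := by
      rintro rfl
      rw [l1_self] at h
      omega
    obtain ⟨R, hRQ, hR⟩ := exists_adj_l1_eq hPQ
    obtain ⟨w, hw⟩ := ih R (by omega)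
    exact ⟨w.concat hRQ, by rw [SimpleGraph.Walk.length_concat, hw]⟩

theorem dist_eq_l1 (P Q : ℤ × ℤ) : (squareFaces.dist P Q : ℤ) = l1 P Q := by
  obtain ⟨w, hw⟩ := exists_walk_length_eq P (l1 P Q).toNat Q
    (Int.toNat_of_nonneg (l1_nonneg P Q)).symm
  have h1 := SimpleGraph.dist_le w
  obtain ⟨w', hw'⟩ := SimpleGraph.Reachable.exists_walk_length_eq_dist ⟨w⟩
  have h2 := l1_le_length w'
  have := l1_nonneg P Q
  omega

theorem pulse_apply (r : ℕ) (f : ℤ) (P : ℤ × ℤ) :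
    pulse squareFaces 0 r f P = if l1 0 P ≤ r then f else 0 := by
  simp only [pulse, ← dist_eq_l1, Nat.cast_le]

/-- Translation of the faces of the square lattice. -/
def translation (a : ℤ × ℤ) : squareFaces ≃g squareFaces where
  toEquiv := Equiv.addRight a
  map_rel_iff' := by simp [adj_iff, l1]

theorem pulse_comp_translation (a h : ℤ × ℤ) (r : ℕ) (f : ℤ) :
    pulse squareFaces (h + a) r f ∘ translation a = pulse squareFaces h r f := by
  funext P
  have : (squareFaces.dist (h + a) (P + a) : ℤ) = squareFaces.dist h P := by
    rw [dist_eq_l1, dist_eq_l1]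
    simp [l1]
  have h' : squareFaces.dist (h + a) (P + a) = squareFaces.dist h P := by exact_mod_cast this
  change (if squareFaces.dist (h + a) (P + a) ≤ r then f else 0) = _
  rw [h']
  rfl

theorem globallyConfluent_pulse_translate (a h : ℤ × ℤ) (r : ℕ) (f : ℤ)
    (hc : GloballyConfluent squareFaces (h + a) (pulse squareFaces (h + a) r f)) :
    GloballyConfluent squareFaces h (pulse squareFaces h r f) := by
  have := hc.comp (translation a)
  rwa [pulse_comp_translation, show (translation a).symm (h + a) = h from
    (translation a).symm_apply_apply h] at this

theorem neg_pulse (hole : ℤ × ℤ) (r : ℕ) (f : ℤ) :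
    -pulse squareFaces hole r f = pulse squareFaces hole r (-f) := by
  funext P
  simp only [pulse, Pi.neg_apply]
  split_ifs <;> simp

theorem globallyConfluent_pulse_neg_iff (hole : ℤ × ℤ) (r : ℕ) (f : ℤ) :
    GloballyConfluent squareFaces hole (pulse squareFaces hole r (-f)) ↔
      GloballyConfluent squareFaces hole (pulse squareFaces hole r f) := by
  constructor <;> intro h
  · have := h.neg
    rwa [neg_pulse, neg_neg] at this
  · have := h.neg
    rwa [neg_pulse] at this

theorem edgeDegree_of_ne {F G : ℤ × ℤ} (hF : F ≠ 0) (hG : G ≠ 0) :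
    edgeDegree 0 F G = 2 := by simp [edgeDegree, hF, hG]

theorem edgeDegree_zero_left {G : ℤ × ℤ} (hG : G ≠ 0) :
    edgeDegree 0 0 G = 1 := by simp [edgeDegree, hG]

theorem edgeDegree_zero_right {F : ℤ × ℤ} (hF : F ≠ 0) :
    edgeDegree 0 F 0 = 1 := by simp [edgeDegree, hF]

/-- The neighbours of the hole carry its value because `r ≥ 1`, and elsewhere no difference exceeds
`1`. -/
theorem stable_pulse {r : ℕ} (hr : 0 < r) {f : ℤ} (h0 : 0 ≤ f) (h1 : f ≤ 1) :
    Stable squareFaces 0 (pulse squareFaces 0 r f) := by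
  rintro c' ⟨F, G, hFG, hd, -⟩
  have hne := hFG.ne
  have h1 : l1 0 F ≤ l1 0 G + 1 := l1_le_of_adj hFG 0
  have h2 : l1 0 G ≤ l1 0 F + 1 := l1_le_of_adj hFG.symm 0
  by_cases hF : F = 0
  · subst hF
    rw [edgeDegree_zero_left hne.symm, pulse_apply, pulse_apply, if_pos (by rw [l1_self]; omega),
      if_pos (by rw [l1_self] at h2; omega)] at hd
    omega
  · by_cases hG : G = 0
    · subst hG
      rw [edgeDegree_zero_right hne, pulse_apply, pulse_apply,
        if_pos (by rw [l1_self] at h1; omega), if_pos (by rw [l1_self]; omega)] at hd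
      omega
    · rw [edgeDegree_of_ne hF hG, pulse_apply, pulse_apply] at hd
      split_ifs at hd <;> omega

/-! ### Elementary bounds and values along the process. -/

section Pulse

variable {r : ℕ} {f : ℤ} {c : Config (ℤ × ℤ)}

theorem pulse_zero (r : ℕ) (f : ℤ) : pulse squareFaces 0 r f 0 = f := by
  rw [pulse_apply, l1_self, if_pos (Int.natCast_nonneg r)]

theorem pulse_nonneg (r : ℕ) (hf : 0 ≤ f) (P : ℤ × ℤ) : 0 ≤ pulse squareFaces 0 r f P := by
  rw [pulse_apply]
  split_ifs <;> omega

theorem pulse_le (r : ℕ) (hf : 0 ≤ f) (P : ℤ × ℤ) : pulse squareFaces 0 r f P ≤ f := by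
  rw [pulse_apply]
  split_ifs <;> omega

theorem reachable_apply_zero (h : Reachable squareFaces 0 (pulse squareFaces 0 r f) c) :
    c 0 = f := by rw [h.hole_eq, pulse_zero]

theorem reachable_le (hf : 0 ≤ f) (h : Reachable squareFaces 0 (pulse squareFaces 0 r f) c)
    (P : ℤ × ℤ) : c P ≤ f := by
  by_cases hP : P = 0
  · rw [hP, reachable_apply_zero h]
  · exact h.le_of_le (fun _ => f) (by simp) (by simp [pulse_zero])
      (fun X _ => pulse_le r hf X) P hP

theorem reachable_nonneg (hf : 0 ≤ f) (h : Reachable squareFaces 0 (pulse squareFaces 0 r f) c)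
    (P : ℤ × ℤ) : 0 ≤ c P := by
  by_cases hP : P = 0
  · rw [hP, reachable_apply_zero h]; exact hf
  · exact h.ge_of_ge (fun _ => 0) (fun X _ => by rw [pulse_zero]; exact pulse_le r hf X) (by simp)
      (fun X _ => pulse_nonneg r hf X) P hP

theorem fire_apply_of_ne {hole F G P : ℤ × ℤ} (h1 : P ≠ F) (h2 : P ≠ G) (c : Config (ℤ × ℤ)) :
    fire hole F G c P = c P := by
  simp only [fire, if_neg h1, if_neg h2, ite_self]

theorem fire_apply_left {hole F : ℤ × ℤ} (hF : F ≠ hole) (G : ℤ × ℤ) (c : Config (ℤ × ℤ)) :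
    fire hole F G c F = c F - 1 := by
  simp only [fire, if_neg hF, if_true]

theorem fire_apply_right {hole F G : ℤ × ℤ} (hG : G ≠ hole) (hFG : F ≠ G)
    (c : Config (ℤ × ℤ)) : fire hole F G c G = c G + 1 := by
  simp only [fire, if_neg hG, if_neg hFG.symm, if_true]

theorem fire_apply_hole {hole F G : ℤ × ℤ} (c : Config (ℤ × ℤ)) :
    fire hole F G c hole = c hole := by
  simp only [fire, if_true]

end Pulse

/-! ### Radius one: the pyramid is the only final configuration. -/

section RadiusOne

variable {f : ℤ}

/-- The bound `f + 1 - d` at distance `d` of the hole (cut off at `0`) for the pulse of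
radius `1`. -/
theorem reachable_le_pyramid {c : Config (ℤ × ℤ)} (hf : 0 ≤ f)
    (h : Reachable squareFaces 0 (pulse squareFaces 0 1 f) c) {P : ℤ × ℤ} (hP : P ≠ 0) :
    c P ≤ max 0 (f + 1 - l1 0 P) := by
  refine h.le_of_le (fun P => max 0 (f + 1 - l1 0 P)) ?_ ?_ ?_ P hP
  · intro F G hFG _ _
    have := l1_le_of_adj hFG.symm 0
    omega
  · intro G hG
    rw [adj_iff] at hG
    rw [pulse_zero, hG]
    omega
  · intro X _
    rw [pulse_apply]
    split_ifs with h <;> push_cast at h <;> omega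

/-- Along a shortest path from the hole, the first edge allows no drop and each later one a drop of
at most `1`. -/
theorem Stable.ge_pyramid {c : Config (ℤ × ℤ)} (h : Stable squareFaces 0 c) (n : ℕ) :
    ∀ P, l1 0 P = n + 1 → c 0 - n ≤ c P := by
  induction n with
  | zero =>
    intro P hP
    by_contra hlt
    have hP0 : P ≠ 0 := ne_zero_iff.2 (by omega)
    refine h _ ⟨0, P, by rw [adj_iff]; exact_mod_cast hP, ?_, rfl⟩
    rw [edgeDegree_zero_left hP0]
    omega
  | succ n ih =>
    intro P hP
    have hP0 : P ≠ 0 := ne_zero_iff.2 (by omega)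
    obtain ⟨R, hR, hd⟩ := exists_adj_l1_eq hP0.symm
    have hR0 : R ≠ 0 := ne_zero_iff.2 (by omega)
    have := ih R (by omega)
    by_contra hlt
    refine h _ ⟨R, P, hR, ?_, rfl⟩
    rw [edgeDegree_of_ne hR0 hP0]
    omega

/-- Measuring deficits from the hole makes the energy drop in both cases: a unit from the hole
reduces a positive deficit, and an ordinary firing brings two deficits at least `2` apart closer
together. -/
theorem sum_sq_fire_lt {c : Config (ℤ × ℤ)} {F G : ℤ × ℤ} {B : Finset (ℤ × ℤ)}
    (hle : ∀ P, c P ≤ c 0) (hFG : squareFaces.Adj F G) (hd : edgeDegree 0 F G ≤ c F - c G)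
    (hF : F ∈ B) (hG : G ∈ B) :
    ∑ P ∈ B, (c 0 - fire 0 F G c P) ^ 2 < ∑ P ∈ B, (c 0 - c P) ^ 2 := by
  have hne := hFG.ne
  rw [← sub_neg, ← Finset.sum_sub_distrib, Finset.sum_eq_add F G hne]
  · by_cases hF0 : F = 0
    · subst hF0
      rw [edgeDegree_zero_left hne.symm] at hd
      rw [fire_apply_right hne.symm hne, fire_apply_hole]
      nlinarith
    · by_cases hG0 : G = 0
      · subst hG0
        rw [edgeDegree_zero_right hne] at hd
        have := hle F
        omega
      · rw [edgeDegree_of_ne hF0 hG0] at hd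
        rw [fire_apply_right hG0 hne, fire_apply_left hF0]
        nlinarith
  · intro P _ hP
    rw [fire_apply_of_ne hP.1 hP.2, sub_self]
  · exact fun h => absurd hF h
  · exact fun h => absurd hG h

theorem terminates_pulse_one (hf : 0 ≤ f) :
    Terminates squareFaces 0 (pulse squareFaces 0 1 f) := by
  rintro ⟨u, hu0, hu⟩
  have hreach : ∀ n, Reachable squareFaces 0 (pulse squareFaces 0 1 f) (u n) := by
    intro n
    induction n with
    | zero => rw [hu0]; exact Relation.ReflTransGen.refl
    | succ n ih => exact Relation.ReflTransGen.tail ih (hu n)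
  -- The pyramid vanishes beyond distance `f`, so all activity stays in this box.
  let B : Finset (ℤ × ℤ) := Finset.Icc (-f) f ×ˢ Finset.Icc (-f) f
  have hB : ∀ n P, 1 ≤ u n P → P ∈ B := by
    intro n P hP
    rw [Finset.mem_product, Finset.mem_Icc, Finset.mem_Icc]
    by_cases hP0 : P = 0
    · subst hP0; simp [hf]
    · have := reachable_le_pyramid hf (hreach n) hP0
      simp only [l1, Prod.fst_zero, Prod.snd_zero, abs_eq_max_neg] at this
      omega
  have hdec : ∀ n, ∑ P ∈ B, (f - u (n + 1) P) ^ 2 < ∑ P ∈ B, (f - u n P) ^ 2 := by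
    intro n
    obtain ⟨F, G, hFG, hd, he⟩ := hu n
    have hne := hFG.ne
    have h0 := reachable_apply_zero (hreach n)
    have hle := reachable_le hf (hreach n)
    have hnn := reachable_nonneg hf (hreach n)
    have hdeg : 1 ≤ edgeDegree 0 F G := by
      simp only [edgeDegree]
      split_ifs with h1 h2 <;> first | omega | exact absurd (h1.trans h2.symm) hne
    have hG : G ∈ B := by
      by_cases hG0 : G = 0
      · subst hG0; simp [B, hf]
      · refine hB (n + 1) G ?_
        rw [he, fire_apply_right hG0 hne]
        have := hnn G
        omega
    have hF : F ∈ B := hB n F (by have := hnn G; omega)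
    have := sum_sq_fire_lt (fun P => by rw [h0]; exact hle P) hFG hd hF hG
    rwa [h0, ← he] at this
  have hbound : ∀ n : ℕ, ∑ P ∈ B, (f - u n P) ^ 2 ≤ ∑ P ∈ B, (f - u 0 P) ^ 2 - n := by
    intro n
    induction n with
    | zero => simp
    | succ n ih =>
      have := hdec n
      push_cast
      omega
  have h1 := hbound (∑ P ∈ B, (f - u 0 P) ^ 2 + 1).toNat
  have h2 : ∀ n, 0 ≤ ∑ P ∈ B, (f - u n P) ^ 2 :=
    fun n => Finset.sum_nonneg fun _ _ => sq_nonneg _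
  have h3 := h2 0
  have h4 := h2 (∑ P ∈ B, (f - u 0 P) ^ 2 + 1).toNat
  omega

theorem globallyConfluent_pulse_one (hf : 0 ≤ f) :
    GloballyConfluent squareFaces 0 (pulse squareFaces 0 1 f) := by
  have hform : ∀ s, Reachable squareFaces 0 (pulse squareFaces 0 1 f) s →
      Stable squareFaces 0 s → ∀ P, P ≠ 0 → s P = max 0 (f + 1 - l1 0 P) := by
    intro s hs hst P hP
    have h1 := reachable_le_pyramid hf hs hP
    have h2 := reachable_nonneg hf hs P
    have h3 := hst.ge_pyramid (l1 0 P - 1).toNat P (by have := ne_zero_iff.1 hP; omega)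
    rw [reachable_apply_zero hs] at h3
    have := ne_zero_iff.1 hP
    omega
  obtain ⟨s, hs, hst⟩ := (terminates_pulse_one hf).exists_stable
  refine ⟨terminates_pulse_one hf, s, ⟨hs, hst⟩, ?_⟩
  rintro t ⟨ht, htt⟩
  funext P
  by_cases hP : P = 0
  · rw [hP, reachable_apply_zero hs, reachable_apply_zero ht]
  · rw [hform s hs hst P hP, hform t ht htt P hP]

end RadiusOne

end SquareLattice

/-! ### Consequences of confluence for larger pulses: the extremal corner. -/

section LargePulse

/-- The configuration `c` can be obtained from the pulse of radius `r` and force `f`. -/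
abbrev PulseReach (r : ℕ) (f : ℤ) (c : Config (ℤ × ℤ)) : Prop :=
  Reachable squareFaces 0 (pulse squareFaces 0 r f) c

variable {r : ℕ} {f : ℤ} {c s : Config (ℤ × ℤ)}

theorem step_fire {F G : ℤ × ℤ} (hF : F ≠ 0) (hG : G ≠ 0) (hFG : squareFaces.Adj F G)
    (h : 2 ≤ c F - c G) : Step squareFaces 0 c (fire 0 F G c) :=
  ⟨F, G, hFG, by rw [edgeDegree_of_ne hF hG]; exact h, rfl⟩

theorem PulseReach.fire {F G : ℤ × ℤ} (hc : PulseReach r f c) (hF : F ≠ 0) (hG : G ≠ 0)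
    (hFG : squareFaces.Adj F G) (h : 2 ≤ c F - c G) : PulseReach r f (fire 0 F G c) :=
  Relation.ReflTransGen.tail hc (step_fire hF hG hFG h)

/-- The maximum principle for a cone with apex `Z`; `hk` keeps the cone above `f` on the neighbours
of the hole. -/
theorem PulseReach.le_of_le {c' : Config (ℤ × ℤ)} (hc : PulseReach r f c)
    (h : Reachable squareFaces 0 c c') (Z : ℤ × ℤ) (k : ℤ) (hk : f ≤ l1 Z 0 - 1 + k)
    (hle : ∀ P, P ≠ 0 → c P ≤ l1 Z P + k) {P : ℤ × ℤ} (hP : P ≠ 0) : c' P ≤ l1 Z P + k := by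
  refine h.le_of_le (fun P => l1 Z P + k) ?_ ?_ hle P hP
  · intro F G hFG _ _
    have := l1_le_of_adj hFG Z
    omega
  · intro G hG
    have := l1_le_of_adj hG Z
    rw [reachable_apply_zero hc]
    omega

theorem PulseReach.ge_of_ge {c' : Config (ℤ × ℤ)} (hf : 0 ≤ f) (hc : PulseReach r f c)
    (h : Reachable squareFaces 0 c c') (Z : ℤ × ℤ) (k : ℤ)
    (hle : ∀ P, P ≠ 0 → k - l1 Z P ≤ c P) {P : ℤ × ℤ} (hP : P ≠ 0) : k - l1 Z P ≤ c' P := by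
  refine h.ge_of_ge (fun P => k - l1 Z P) ?_ ?_ hle P hP
  · intro X _
    rw [reachable_apply_zero hc]
    exact reachable_le hf hc X
  · intro F G hFG _ _
    have := l1_le_of_adj hFG.symm Z
    omega

/-- Positivity is never lost: the downward cone of height `1` at `P` is nonpositive at every other
face. -/
theorem PulseReach.one_le {c' : Config (ℤ × ℤ)} (hf : 0 ≤ f) (hc : PulseReach r f c)
    (h : Reachable squareFaces 0 c c') {P : ℤ × ℤ} (hP : P ≠ 0) (h1 : 1 ≤ c P) : 1 ≤ c' P := by
  have := hc.ge_of_ge hf h P 1 (fun Q _ => ?_) hP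
  · rwa [l1_self, sub_zero] at this
  · have h0 := l1_nonneg P Q
    have hn := reachable_nonneg hf hc Q
    by_cases hPQ : P = Q
    · subst hPQ; omega
    · obtain ⟨R, -, hR⟩ := exists_adj_l1_eq hPQ
      have := l1_nonneg P R
      omega

/-- Pushing one unit along a descending stretch of a row and then to a neighbour of its end. -/
theorem reachable_fire_row {y : ℤ} (n : ℕ) : ∀ {x : ℤ} {Z : ℤ × ℤ}
    {c : Config (ℤ × ℤ)}, (∀ i : ℕ, i < n → 1 ≤ c (x + i, y) - c (x + i + 1, y)) →
    2 ≤ c (x + n, y) - c Z → squareFaces.Adj (x + n, y) Z → Z ≠ 0 →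
    (∀ i : ℕ, i ≤ n → (x + i, y) ≠ Z ∧ ((x + i, y) : ℤ × ℤ) ≠ 0) →
    Reachable squareFaces 0 c (fire 0 (x, y) Z c) := by
  induction n with
  | zero =>
    intro x Z c _ h2 hadj hZ hne
    have h0 := (hne 0 le_rfl).2
    simp only [Nat.cast_zero, add_zero] at *
    exact Relation.ReflTransGen.single (step_fire h0 hZ hadj h2)
  | succ n ih =>
    intro x Z c h1 h2 hadj hZ hne
    have hl := hne (n + 1) le_rfl
    have hm := hne n (Nat.le_succ n)
    have h1n := h1 n (Nat.lt_succ_self n)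
    have hcast : (x + ((n + 1 : ℕ) : ℤ), y) = (x + n + 1, y) := by push_cast; ring_nf
    rw [hcast] at hl h2 hadj
    -- The far end fires first; its loss widens the preceding gap to `2`, so the unit can be
    -- replaced from behind.
    set c' := fire 0 (x + n + 1, y) Z c with hc'
    have hs : Step squareFaces 0 c c' := step_fire hl.2 hZ hadj h2
    have hval : ∀ i : ℕ, i ≤ n → c' (x + i, y) = c (x + i, y) := by
      intro i hi
      refine fire_apply_of_ne ?_ (hne i (by omega)).1 c
      simp only [ne_eq, Prod.mk.injEq, not_and]
      omega
    have hval' : c' (x + n + 1, y) = c (x + n + 1, y) - 1 := fire_apply_left hl.2 Z c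
    have := ih (x := x) (Z := (x + n + 1, y)) (c := c') ?_ ?_ ?_ hl.2 ?_
    · refine Relation.ReflTransGen.head hs ?_
      suffices he : fire 0 (x, y) Z c = fire 0 (x, y) (x + n + 1, y) c' by rw [he]; exact this
      have hx := hne 0 (Nat.zero_le _)
      simp only [Nat.cast_zero, add_zero] at hx
      have hx' : ((x, y) : ℤ × ℤ) ≠ (x + n + 1, y) := by
        simp only [ne_eq, Prod.mk.injEq, not_and]
        omega
      funext P
      by_cases hP0 : P = 0
      · subst hP0
        rw [fire_apply_hole, fire_apply_hole, hc', fire_apply_hole]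
      · by_cases hP1 : P = (x, y)
        · subst hP1
          rw [fire_apply_left hx.2, fire_apply_left hx.2, hc', fire_apply_of_ne hx' hx.1]
        · by_cases hP2 : P = (x + n + 1, y)
          · subst hP2
            rw [fire_apply_of_ne hP1 hl.1, fire_apply_right hl.2 hx', hval']
            ring
          · rw [fire_apply_of_ne hP1 hP2]
            by_cases hP3 : P = Z
            · subst hP3
              rw [fire_apply_right hZ hx.1, hc', fire_apply_right hZ hl.1]
            · rw [fire_apply_of_ne hP1 hP3, hc', fire_apply_of_ne hP2 hP3]
    · intro i hi
      have e : (x + (i : ℤ) + 1, y) = (x + ((i + 1 : ℕ) : ℤ), y) := by push_cast; ring_nf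
      have := h1 i (by omega)
      rw [e] at *
      rwa [hval i (by omega), hval (i + 1) (by omega)]
    · rw [hval n le_rfl, hval']
      omega
    · rw [adj_iff]
      simp only [l1, abs_eq_max_neg]
      omega
    · intro i hi
      refine ⟨?_, (hne i (by omega)).2⟩
      simp only [ne_eq, Prod.mk.injEq, not_and]
      omega

theorem pulse_mk (x y : ℤ) :
    pulse squareFaces 0 r f (x, y) = if |x| + |y| ≤ r then f else 0 := by
  rw [pulse_apply]
  simp [l1]

theorem mk_ne_zero {x y : ℤ} (h : x ≠ 0 ∨ y ≠ 0) : ((x, y) : ℤ × ℤ) ≠ 0 := by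
  simp only [ne_eq, Prod.mk_eq_zero]
  tauto

theorem adj_right (x y : ℤ) : squareFaces.Adj (x, y) (x + 1, y) := by
  simp [adj_iff, l1]

theorem adj_up (x y : ℤ) : squareFaces.Adj (x, y) (x, y + 1) := by
  simp [adj_iff, l1]

/-- From a pulse of radius at least `2`, a face at distance `f + 1` of the hole gets flow. -/
theorem exists_reach_one_le (hr : 2 ≤ r) (hf : 2 ≤ f)
    (ht : Terminates squareFaces 0 (pulse squareFaces 0 r f)) :
    ∃ c, PulseReach r f c ∧ 1 ≤ c (f, 1) := by
  -- Since `r ≥ 2`, the face `(1, 1)` starts at `f`; forbidding it to fire stores a surplus there.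
  obtain ⟨c, hc, hc11, hst⟩ := ht.exists_restricted (fun _ F _ => F ≠ (1, 1))
    (fun c => f ≤ c (1, 1))
    (by rw [pulse_mk, if_pos (by norm_num; omega)]) (by
      intro x F G _ hx _ hF _
      simp only [fire]
      split_ifs with h1 h2 h3
      · exact hx
      · exact absurd h2.symm hF
      · omega
      · exact hx)
  have h0 := reachable_apply_zero hc
  have hle := reachable_le (by omega) hc
  have hlip : ∀ F G : ℤ × ℤ, F ≠ 0 → G ≠ 0 → squareFaces.Adj F G → F ≠ (1, 1) →
      c F ≤ c G + 1 := by
    intro F G hF hG hFG hF1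
    have := hst F G hFG hF1
    rw [edgeDegree_of_ne hF hG] at this
    omega
  have h10 : f ≤ c (1, 0) := by
    have := hst 0 (1, 0) (by simp [adj_iff, l1]) (by simp [Prod.ext_iff])
    rw [edgeDegree_zero_left (mk_ne_zero (by omega))] at this
    omega
  have h20 : f - 1 ≤ c (2, 0) := by
    have := hlip (1, 0) (2, 0) (mk_ne_zero (by omega)) (mk_ne_zero (by omega))
      (adj_right 1 0) (by simp)
    omega
  have hrow : ∀ n : ℕ, f - 2 - n ≤ c (2 + n, 1) := by
    intro n
    induction n with
    | zero =>
      have := hlip (2, 0) (2, 1) (mk_ne_zero (by omega)) (mk_ne_zero (by omega))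
        (adj_up 2 0) (by simp)
      simp only [Nat.cast_zero, add_zero]
      omega
    | succ n ih =>
      have := hlip (2 + n, 1) (2 + n + 1, 1) (mk_ne_zero (by omega)) (mk_ne_zero (by omega))
        (adj_right _ 1) (by simp only [ne_eq, Prod.mk.injEq, not_and]; omega)
      push_cast
      rw [← add_assoc]
      omega
  -- The surplus of `(1, 1)` travels along the row: wherever the lower bound of `hrow` is not
  -- already exceeded, the gap is large enough to pass one unit on.
  have hpush : ∀ n : ℕ, ∃ x, PulseReach r f x ∧ f - 1 - n ≤ x (2 + n, 1) ∧
      ∀ m : ℕ, n ≤ m → f - 2 - m ≤ x (2 + m, 1) := by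
    intro n
    induction n with
    | zero =>
      by_cases h : f - 1 ≤ c (2, 1)
      · exact ⟨c, hc, by simpa using h, fun m _ => hrow m⟩
      · refine ⟨fire 0 (1, 1) (2, 1) c, PulseReach.fire hc (mk_ne_zero (by omega)) (mk_ne_zero (by omega))
          (adj_right 1 1) (by omega), ?_, ?_⟩
        · simp only [Nat.cast_zero, add_zero]
          rw [fire_apply_right (mk_ne_zero (by omega)) (by simp)]
          have := hrow 0
          simp only [Nat.cast_zero, add_zero] at this
          omega
        · intro m _
          have := hrow m
          simp only [fire, mk_ne_zero (show (2 + (m : ℤ)) ≠ 0 ∨ (1 : ℤ) ≠ 0 by omega), if_false,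
            Prod.mk.injEq]
          split_ifs <;> omega
    | succ n ih =>
      obtain ⟨x, hx, hx1, hx2⟩ := ih
      have h3 := hx2 (n + 1) (Nat.le_succ n)
      push_cast at h3 ⊢
      by_cases h : f - 1 - (n + 1) ≤ x (2 + (n + 1), 1)
      · exact ⟨x, hx, h, fun m hm => hx2 m (by omega)⟩
      · have hn0 : ((2 + (n + 1), 1) : ℤ × ℤ) ≠ 0 := mk_ne_zero (by omega)
        refine ⟨fire 0 (2 + n, 1) (2 + (n + 1), 1) x, hx.fire (mk_ne_zero (by omega)) hn0
          (by rw [← add_assoc]; exact adj_right _ 1) (by omega), ?_, ?_⟩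
        · rw [fire_apply_right hn0 (by simp)]
          omega
        · intro m hm
          have := hx2 m (by omega)
          simp only [fire, mk_ne_zero (show (2 + (m : ℤ)) ≠ 0 ∨ (1 : ℤ) ≠ 0 by omega), if_false,
            Prod.mk.injEq]
          split_ifs <;> omega
  obtain ⟨x, hx, hx1, -⟩ := hpush (f - 2).toNat
  refine ⟨x, hx, ?_⟩
  rw [show 2 + ((f - 2).toNat : ℤ) = f by omega] at hx1
  omega

theorem finite_support (hc : PulseReach r f c) : {P | c P ≠ 0}.Finite := by
  induction hc with
  | refl =>
    refine Set.Finite.subset (Set.toFinite (Set.Icc (-(r : ℤ)) r ×ˢ Set.Icc (-(r : ℤ)) r)) ?_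
    rintro ⟨x, y⟩ hP
    rw [Set.mem_ofPred_eq, pulse_mk] at hP
    have : |x| + |y| ≤ r := by
      by_contra h
      rw [if_neg h] at hP
      exact hP rfl
    rw [Set.mem_prod, Set.mem_Icc, Set.mem_Icc]
    simp only [abs_eq_max_neg] at this
    omega
  | @tail x y _ hs ih =>
    obtain ⟨F, G, -, -, rfl⟩ := hs
    refine (ih.union (Set.toFinite {F, G})).subset ?_
    intro P hP
    by_contra h
    simp only [Set.mem_union, Set.mem_ofPred_eq, Set.mem_insert_iff, Set.mem_singleton_iff,
      not_or, not_not] at h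
    exact hP (by rw [fire_apply_of_ne h.2.1 h.2.2, h.1])

/-- The unique final configuration has all symmetries of the pulse. -/
theorem final_comp_eq (hs : PulseReach r f s) (hst : Stable squareFaces 0 s)
    (hu : ∀ t, PulseReach r f t → Stable squareFaces 0 t → t = s)
    (e : squareFaces ≃g squareFaces) (he : ∀ P, l1 0 (e P) = l1 0 P) : s ∘ e = s := by
  have h0 : e 0 = 0 := by
    by_contra h
    have h1 := ne_zero_iff.1 h
    rw [he, l1_self] at h1
    exact lt_irrefl _ h1
  have h0' : e.symm 0 = 0 := e.symm_apply_eq.2 h0.symm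
  refine hu _ ?_ ?_
  · have := reachable_map (fun c => c ∘ e) (fun x y h => h.comp e) hs
    rw [h0'] at this
    convert this using 1
    funext P
    simp only [Function.comp_apply, pulse_apply, he]
  · intro x hx
    have := hx.comp e.symm
    rw [show e.symm.symm 0 = 0 from h0] at this
    refine hst (x ∘ e.symm) ?_
    convert this using 1
    funext P
    simp

/-- Reflection of the square lattice in the vertical axis. -/
def reflection : squareFaces ≃g squareFaces where
  toEquiv := (Equiv.neg ℤ).prodCongr (Equiv.refl ℤ)
  map_rel_iff' := by
    intro P Q
    simp only [adj_iff, l1, abs_eq_max_neg, Equiv.prodCongr_apply, Prod.map, Equiv.neg_apply,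
      Equiv.refl_apply]
    omega

/-- Reflection of the square lattice in the diagonal. -/
def diagonal : squareFaces ≃g squareFaces where
  toEquiv := Equiv.prodComm ℤ ℤ
  map_rel_iff' := by
    intro P Q
    simp only [adj_iff, l1, Equiv.prodComm_apply, Prod.fst_swap, Prod.snd_swap]
    rw [add_comm]

theorem final_symm (hs : PulseReach r f s) (hst : Stable squareFaces 0 s)
    (hu : ∀ t, PulseReach r f t → Stable squareFaces 0 t → t = s) :
    (∀ x y, s (-x, y) = s (x, y)) ∧ ∀ x y, s (y, x) = s (x, y) := by
  have h1 := final_comp_eq hs hst hu reflection (fun P => by simp [l1, reflection])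
  have h2 := final_comp_eq hs hst hu diagonal (fun P => by simp [l1, diagonal, add_comm])
  exact ⟨fun x y => congrFun h1 (x, y), fun x y => congrFun h2 (x, y)⟩

/-- `s` is reached from everything reachable, and `(D - b, b)` is the lowest face
of the first quadrant among the outermost faces on which `s` is positive. -/
structure Corner (r : ℕ) (f : ℤ) (s : Config (ℤ × ℤ)) (D b : ℤ) : Prop where
  two_le : 2 ≤ f
  final : ∀ c, PulseReach r f c → Reachable squareFaces 0 c s
  le_of_pos : ∀ P, 1 ≤ s P → l1 0 P ≤ D
  pos : 1 ≤ s (D - b, b)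
  not_pos : ∀ y, 0 ≤ y → y < b → s (D - y, y) ≤ 0
  nonneg : 0 ≤ b
  two_mul_le : 2 * b ≤ D
  force_lt : f + 1 ≤ D
  radius_lt : (r : ℤ) + 1 ≤ D
  radius_lt' : 3 ≤ f → (r : ℤ) + 2 ≤ D

theorem exists_corner (hr : 2 ≤ r) (hf : 2 ≤ f)
    (h : GloballyConfluent squareFaces 0 (pulse squareFaces 0 r f)) :
    ∃ s D b, Corner r f s D b := by
  obtain ⟨s, hst, hfin, hu⟩ := h.exists_final
  have hs : PulseReach r f s := hfin _ Relation.ReflTransGen.refl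
  have hfin0 : ∀ c, PulseReach r f c → ∀ P, P ≠ 0 → 1 ≤ c P → 1 ≤ s P :=
    fun c hc P hP h1 => hc.one_le (by omega) (hfin c hc) hP h1
  obtain ⟨hrefl, hdiag⟩ := final_symm hs hst hu
  have hfinite : {P | 1 ≤ s P}.Finite :=
    (finite_support hs).subset fun P (hP : 1 ≤ s P) => by simp only [Set.mem_ofPred_eq]; omega
  obtain ⟨P₀, hP₀, hmax⟩ := Set.exists_max_image _ (l1 0) hfinite
    ⟨0, by rw [Set.mem_ofPred_eq, reachable_apply_zero hs]; omega⟩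
  simp only [Set.mem_ofPred_eq] at hP₀ hmax
  have hpos : ∀ x y, s (|x|, |y|) = s (x, y) := by
    have h1 : ∀ x y, s (|x|, y) = s (x, y) := by
      intro x y
      rcases abs_choice x with h | h <;> rw [h]
      exact hrefl x y
    intro x y
    rw [h1, ← hdiag, h1, hdiag]
  have hex : ∃ b : ℕ, 1 ≤ s (l1 0 P₀ - b, b) ∧ (b : ℤ) ≤ l1 0 P₀ := by
    obtain ⟨x, y⟩ := P₀
    refine ⟨y.natAbs, ?_, ?_⟩
    · rw [← hpos] at hP₀
      simpa [l1] using hP₀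
    · simp [l1]
  set D := l1 0 P₀ with hD
  classical
  obtain ⟨hb1, hb2⟩ := Nat.find_spec hex
  have hmin : ∀ y : ℤ, 0 ≤ y → y < Nat.find hex → s (D - y, y) ≤ 0 := by
    intro y hy0 hy
    have := Nat.find_min hex (m := y.toNat) (by omega)
    rw [Int.toNat_of_nonneg hy0] at this
    by_contra h'
    exact this ⟨by omega, by omega⟩
  refine ⟨s, D, Nat.find hex, hf, hfin, hmax, hb1, hmin, by omega, ?_, ?_, ?_, ?_⟩
  -- Otherwise the mirror image `(b, D - b)` in the diagonal would be a lower positive face.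
  · by_contra hlt
    have := hmin (D - Nat.find hex) (by omega) (by omega)
    rw [sub_sub_cancel, hdiag] at this
    omega
  · obtain ⟨c, hc, hc1⟩ := exists_reach_one_le hr hf h.1
    have := hmax _ (hfin0 c hc _ (mk_ne_zero (by omega)) hc1)
    simp only [l1, abs_eq_max_neg, Prod.fst_zero, Prod.snd_zero] at this
    omega
  · have h0 : PulseReach r f (pulse squareFaces 0 r f) := Relation.ReflTransGen.refl
    have hv1 : pulse squareFaces 0 r f (r, 0) = f := by rw [pulse_mk, if_pos (by simp)]
    have hv2 : pulse squareFaces 0 r f (r + 1, 0) = 0 := by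
      rw [pulse_mk, if_neg]
      simp only [abs_eq_max_neg]
      omega
    have hne : ((r + 1, 0) : ℤ × ℤ) ≠ 0 := mk_ne_zero (by omega)
    have h1 := h0.fire (mk_ne_zero (by omega)) hne (adj_right r 0) (by omega)
    have h2 := hmax _ (hfin0 _ h1 _ hne (by
      rw [fire_apply_right hne (by simp)]; omega))
    simp only [l1, abs_eq_max_neg, Prod.fst_zero, Prod.snd_zero] at h2
    omega
  -- Two units are gathered on `(r, 1)` from its inner neighbours, which allows a firing to distance
  -- `r + 2`; the second gathering step needs `f ≥ 3`.
  · intro hf3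
    have h0 : PulseReach r f (pulse squareFaces 0 r f) := Relation.ReflTransGen.refl
    have hv1 : pulse squareFaces 0 r f (r, 0) = f := by rw [pulse_mk, if_pos (by simp)]
    have hv2 : pulse squareFaces 0 r f (r - 1, 1) = f := by
      rw [pulse_mk, if_pos]
      simp only [abs_eq_max_neg]
      omega
    have hv3 : pulse squareFaces 0 r f (r, 1) = 0 := by
      rw [pulse_mk, if_neg]
      simp only [abs_eq_max_neg]
      omega
    have hv4 : pulse squareFaces 0 r f (r + 1, 1) = 0 := by
      rw [pulse_mk, if_neg]
      simp only [abs_eq_max_neg]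
      omega
    have hn1 : ((r, 0) : ℤ × ℤ) ≠ 0 := mk_ne_zero (by omega)
    have hn2 : ((r - 1, 1) : ℤ × ℤ) ≠ 0 := mk_ne_zero (by omega)
    have hn3 : ((r, 1) : ℤ × ℤ) ≠ 0 := mk_ne_zero (by omega)
    have hn4 : ((r + 1, 1) : ℤ × ℤ) ≠ 0 := mk_ne_zero (by omega)
    have h1 := h0.fire hn1 hn3 (adj_up r 0) (by omega)
    have h2 := h1.fire hn2 hn3 (by simpa using adj_right (r - 1) 1) (by
      rw [fire_apply_right hn3 (by simp), fire_apply_of_ne (by simp) (by simp)]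
      omega)
    have h3 := h2.fire hn3 hn4 (adj_right r 1) (by
      rw [fire_apply_right hn3 (by simp), fire_apply_right hn3 (by simp),
        fire_apply_of_ne (by simp only [ne_eq, Prod.mk.injEq, not_and]; omega) (by simp),
        fire_apply_of_ne (by simp) (by simp)]
      omega)
    have h4 := hmax _ (hfin0 _ h3 _ hn4 (by
      rw [fire_apply_right hn4 (by simp),
        fire_apply_of_ne (by simp only [ne_eq, Prod.mk.injEq, not_and]; omega) (by simp),
        fire_apply_of_ne (by simp) (by simp)]
      omega))
    simp only [l1, abs_eq_max_neg, Prod.fst_zero, Prod.snd_zero] at h4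
    omega

end LargePulse

/-! ### The frozen configuration and the two incompatible firing orders. -/

section FrozenPulse

variable {r : ℕ} {f D b : ℤ} {c s : Config (ℤ × ℤ)}

theorem Corner.one_le (hC : Corner r f s D b) (hc : PulseReach r f c) {P : ℤ × ℤ} (hP : P ≠ 0)
    (h : 1 ≤ c P) : 1 ≤ s P :=
  hc.one_le (by have := hC.two_le; omega) (hC.final c hc) hP h

/-- A configuration obtained from the pulse in which nothing can fire except into the corner
`(D - b, b)`, its upper left neighbour `(D - b - 1, b + 1)`, and possibly into the common inner
neighbour `(D - b - 1, b)` of these two. -/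
structure Frozen (r : ℕ) (f D b : ℤ) (c : Config (ℤ × ℤ)) : Prop where
  reach : PulseReach r f c
  corner_eq : c (D - b, b) = 0
  next_eq : c (D - b - 1, b + 1) = 0
  inner_le : c (D - b - 1, b) ≤ 2
  le_add_one' : ∀ P G : ℤ × ℤ, P ≠ 0 → G ≠ 0 → squareFaces.Adj P G → G ≠ (D - b, b) →
    G ≠ (D - b - 1, b + 1) → (G = (D - b - 1, b) → c G ≤ 1) → c P ≤ c G + 1
  le_apply : ∀ G : ℤ × ℤ, squareFaces.Adj 0 G → f ≤ c G

theorem Corner.exists_frozen (hC : Corner r f s D b)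
    (ht : Terminates squareFaces 0 (pulse squareFaces 0 r f)) : ∃ c, Frozen r f D b c := by
  have hf := hC.two_le
  have hb := hC.nonneg
  have hbD := hC.two_mul_le
  have hfD := hC.force_lt
  have hrD := hC.radius_lt
  have hX0 : ((D - b, b) : ℤ × ℤ) ≠ 0 := mk_ne_zero (by omega)
  have hY0 : ((D - b - 1, b + 1) : ℤ × ℤ) ≠ 0 := mk_ne_zero (by omega)
  have hF0 : ((D - b - 1, b) : ℤ × ℤ) ≠ 0 := mk_ne_zero (by omega)
  obtain ⟨c, hc, ⟨h1, h2, h3⟩, hst⟩ := ht.exists_restricted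
    (fun x _ G => G ≠ (D - b, b) ∧ G ≠ (D - b - 1, b + 1) ∧ (G = (D - b - 1, b) → x G ≤ 1))
    (fun x => x (D - b, b) = 0 ∧ x (D - b - 1, b + 1) = 0 ∧ x (D - b - 1, b) ≤ 2) (by
      simp only [pulse_mk, abs_eq_max_neg]
      -- The inner neighbour has distance `D - 1`: if `f ≥ 3` it is outside the pulse, and if `f =
      -- 2` it starts with at most `2`.
      refine ⟨if_neg (by omega), if_neg (by omega), ?_⟩
      have := hC.radius_lt'
      split_ifs <;> omega) (by
      rintro x P G hx ⟨h1, h2, h3⟩ hadj ⟨g1, g2, g3⟩ hd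
      have hn := reachable_nonneg (by omega) hx G
      have hdeg : 1 ≤ edgeDegree 0 P G := by
        have := hadj.ne
        simp only [edgeDegree]
        split_ifs with e1 e2 <;> first | omega | exact absurd (e1.trans e2.symm) this
      have hpos : 1 ≤ x P := by omega
      refine ⟨?_, ?_, ?_⟩
      · rw [fire_apply_of_ne _ g1.symm, h1]
        rintro rfl
        omega
      · rw [fire_apply_of_ne _ g2.symm, h2]
        rintro rfl
        omega
      · simp only [fire, hF0, if_false]
        split_ifs with e1 e2
        · omega
        · have := g3 e2.symm
          rw [← e2] at this
          omega
        · exact h3)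
  refine ⟨c, hc, h1, h2, h3, ?_, ?_⟩
  · intro P G hP hG hadj g1 g2 g3
    have := hst P G hadj ⟨g1, g2, g3⟩
    rw [edgeDegree_of_ne hP hG] at this
    omega
  · intro G hG
    have h0 := reachable_apply_zero hc
    have hG0 : G ≠ 0 := hG.ne.symm
    rw [adj_iff] at hG
    have hne : ∀ x y : ℤ, 2 ≤ x + y → G ≠ (x, y) := by
      rintro x y h rfl
      simp only [l1, abs_eq_max_neg, Prod.fst_zero, Prod.snd_zero] at hG
      omega
    have := hst 0 G (adj_iff.2 hG) ⟨hne _ _ (by omega), hne _ _ (by omega),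
      fun h => absurd h (hne _ _ (by omega))⟩
    rw [edgeDegree_zero_left hG0] at this
    omega

theorem exists_outward (P : ℤ × ℤ) : ∃ Z Z', Z ≠ Z' ∧ squareFaces.Adj P Z ∧
    squareFaces.Adj P Z' ∧ l1 0 Z = l1 0 P + 1 ∧ l1 0 Z' = l1 0 P + 1 := by
  obtain ⟨x, y⟩ := P
  refine ⟨(if 0 ≤ x then x + 1 else x - 1, y), (x, if 0 ≤ y then y + 1 else y - 1), ?_, ?_, ?_,
    ?_, ?_⟩
  · simp only [ne_eq, Prod.mk.injEq, not_and]
    split_ifs <;> omega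
  all_goals
    simp only [adj_iff, l1, abs_eq_max_neg, Prod.fst_zero, Prod.snd_zero]
    split_ifs <;> omega

theorem exists_outward_ne (P Q : ℤ × ℤ) :
    ∃ Z, squareFaces.Adj P Z ∧ l1 0 Z = l1 0 P + 1 ∧ Z ≠ Q := by
  obtain ⟨Z, Z', hne, h1, h2, h3, h4⟩ := exists_outward P
  by_cases h : Z = Q
  · exact ⟨Z', h2, h4, fun h' => hne (h.trans h'.symm)⟩
  · exact ⟨Z, h1, h3, h⟩

/-- Both blocked faces are outward neighbours of the inner face only, and every face has at least
two outward neighbours. -/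
theorem exists_outward_ne_ne {P : ℤ × ℤ} {D : ℤ} (hb : 0 ≤ b) (hbD : b < D)
    (h : P ≠ (D - b - 1, b)) : ∃ Z, squareFaces.Adj P Z ∧ l1 0 Z = l1 0 P + 1 ∧
      Z ≠ (D - b, b) ∧ Z ≠ (D - b - 1, b + 1) := by
  obtain ⟨x, y⟩ := P
  simp only [ne_eq, Prod.mk.injEq, not_and] at h
  by_cases h' : (if 0 ≤ x then x + 1 else x - 1) = D - b - 1 ∧ y = b + 1
  · refine ⟨(x, y + 1), adj_up x y, ?_, ?_, ?_⟩
    · simp only [l1, abs_eq_max_neg, Prod.fst_zero, Prod.snd_zero]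
      omega
    · simp only [ne_eq, Prod.mk.injEq, not_and]
      omega
    · simp only [ne_eq, Prod.mk.injEq, not_and]
      omega
  · refine ⟨(if 0 ≤ x then x + 1 else x - 1, y), ?_, ?_, ?_, ?_⟩
    · simp only [adj_iff, l1, abs_eq_max_neg]
      split_ifs <;> omega
    · simp only [l1, abs_eq_max_neg, Prod.fst_zero, Prod.snd_zero]
      split_ifs <;> omega
    · simp only [ne_eq, Prod.mk.injEq, not_and]
      split_ifs <;> omega
    · simpa only [ne_eq, Prod.mk.injEq] using h'

/-- Positive flow would persist in `s`, contrary to the maximality of `D`. -/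
theorem Corner.le_zero (hC : Corner r f s D b) (hc : PulseReach r f c) {P : ℤ × ℤ}
    (hP : D < l1 0 P) : c P ≤ 0 := by
  by_contra h
  have h0 := l1_nonneg 0 P
  have hf := hC.two_le
  have hfD := hC.force_lt
  have := hC.le_of_pos P (hC.one_le hc (ne_zero_iff.2 (by omega)) (by omega))
  omega

/-- An outermost face never holds more than one unit, as it would pass one on outward. -/
theorem Corner.le_one (hC : Corner r f s D b) (hc : PulseReach r f c) {P : ℤ × ℤ}
    (hP : l1 0 P = D) : c P ≤ 1 := by
  by_contra h
  have hf := hC.two_le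
  have hfD := hC.force_lt
  obtain ⟨Z, -, -, hadj, -, hZ, -⟩ := exists_outward P
  have hP0 : P ≠ 0 := ne_zero_iff.2 (by omega)
  have hZ0 : Z ≠ 0 := ne_zero_iff.2 (by omega)
  have h1 := hC.le_zero hc (P := Z) (by omega)
  have h2 := hC.le_zero (PulseReach.fire hc hP0 hZ0 hadj (by omega)) (P := Z) (by omega)
  rw [fire_apply_right hZ0 hadj.ne] at h2
  have := reachable_nonneg (by omega) hc Z
  omega

/-- Going inward from the outermost faces, which hold at most `1`, values grow by at most `1` per
layer. Choosing an outward neighbour away from the restricted faces makes this work; the inner face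
itself is covered by its cap. -/
theorem Frozen.le_of_l1_eq (hc : Frozen r f D b c) (hC : Corner r f s D b) (n : ℕ) :
    ∀ P, P ≠ 0 → l1 0 P = D - 1 - n → c P ≤ n + 2 := by
  have hb := hC.nonneg
  have hbD := hC.two_mul_le
  have hf := hC.two_le
  have hfD := hC.force_lt
  have hnorm : ∀ x y Z, 0 ≤ x → 0 ≤ y → l1 0 Z ≠ x + y → Z ≠ (x, y) := by
    rintro x y _ hx hy h rfl
    simp only [l1, abs_eq_max_neg, Prod.fst_zero, Prod.snd_zero] at h
    omega
  induction n with
  | zero =>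
    intro P hP hd
    by_cases hPF : P = (D - b - 1, b)
    · rw [hPF]
      simpa using hc.inner_le
    · obtain ⟨Z, hadj, hZ, h1, h2⟩ := exists_outward_ne_ne hb (by omega) hPF
      have h3 := hC.le_one hc.reach (P := Z) (by simp at hd; omega)
      have := hc.le_add_one' P Z hP (ne_zero_iff.2 (by omega)) hadj h1 h2
        (fun h => absurd h (hnorm _ _ Z (by omega) hb (by simp at hd; omega)))
      simp
      omega
  | succ n ih =>
    intro P hP hd
    obtain ⟨Z, hadj, hZ, h1⟩ := exists_outward_ne P (D - b - 1, b)
    have hp := ne_zero_iff.1 hP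
    push_cast at hd ⊢
    have h3 := ih Z (ne_zero_iff.2 (by omega)) (by omega)
    have := hc.le_add_one' P Z hP (ne_zero_iff.2 (by omega)) hadj
      (hnorm _ _ Z (by omega) hb (by omega)) (hnorm _ _ Z (by omega) (by omega) (by omega))
      (fun h => absurd h h1)
    omega

theorem Frozen.le_sub (hc : Frozen r f D b c) (hC : Corner r f s D b) {P : ℤ × ℤ} (hP : P ≠ 0)
    (hd : l1 0 P ≤ D) : c P ≤ D + 1 - l1 0 P := by
  by_cases h : l1 0 P = D
  · rw [h]
    have := hC.le_one hc.reach h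
    omega
  · have := hc.le_of_l1_eq hC (D - 1 - l1 0 P).toNat P hP (by omega)
    omega

/-- The exception for the inner face disappears: if it holds at least `2`, its neighbours, at
distance `D` or `D - 2`, hold at most `3` anyway. -/
theorem Frozen.le_add_one (hc : Frozen r f D b c) (hC : Corner r f s D b) {P G : ℤ × ℤ}
    (hP : P ≠ 0) (hG : G ≠ 0) (hadj : squareFaces.Adj P G) (h1 : G ≠ (D - b, b))
    (h2 : G ≠ (D - b - 1, b + 1)) : c P ≤ c G + 1 := by
  by_cases h : G = (D - b - 1, b) → c G ≤ 1
  · exact hc.le_add_one' P G hP hG hadj h1 h2 h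
  · rw [Classical.not_imp] at h
    have h3 : l1 0 P = D ∨ l1 0 P = D - 2 := by
      obtain ⟨rfl, -⟩ := h
      have hb := hC.nonneg
      have hbD := hC.two_mul_le
      have hf := hC.two_le
      have hfD := hC.force_lt
      rw [adj_iff] at hadj
      simp only [l1, abs_eq_max_neg, Prod.fst_zero, Prod.snd_zero] at hadj ⊢
      omega
    have := hc.le_sub hC hP (by omega)
    omega

/-- Rows below the corner carry no excess. -/
theorem Frozen.le_of_row_lt (hc : Frozen r f D b c) (hC : Corner r f s D b) {y : ℤ} (hy : 0 ≤ y)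
    (hyb : y < b) (n : ℕ) : ∀ x, 0 ≤ x → ((x, y) : ℤ × ℤ) ≠ 0 → x + y = D - n → c (x, y) ≤ n := by
  have hbD := hC.two_mul_le
  have hf := hC.two_le
  have hfD := hC.force_lt
  induction n with
  | zero =>
    intro x hx h0 hxy
    have hx' : x = D - y := by simp at hxy; omega
    by_contra h
    have h1 := hC.one_le hc.reach h0 (by simp at h; omega)
    have h2 := hC.not_pos y hy hyb
    rw [hx'] at h1
    omega
  | succ n ih =>
    intro x hx h0 hxy
    push_cast at hxy ⊢
    have hne : ((x + 1, y) : ℤ × ℤ) ≠ 0 := mk_ne_zero (by omega)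
    have h1 := ih (x + 1) (by omega) hne (by omega)
    have h2 := hc.le_add_one hC h0 hne (adj_right x y)
      (by simp only [ne_eq, Prod.mk.injEq, not_and]; omega)
      (by simp only [ne_eq, Prod.mk.injEq, not_and]; omega)
    omega

/-- A face violating the bound by the distance from a face `(u, b)` lies in the row of `b`,
between the hole and `(u, b)`, and holds exactly one unit too many. -/
theorem Frozen.row_of_lt (hc : Frozen r f D b c) (hC : Corner r f s D b) {u : ℤ}
    (hu : 0 ≤ u) {x y : ℤ} (huD : u ≤ D - b) (h0 : ((x, y) : ℤ × ℤ) ≠ 0)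
    (hxy : l1 (u, b) (x, y) + (D - u - b) < c (x, y)) :
    y = b ∧ 0 ≤ x ∧ x ≤ u ∧ x < D - b ∧ c (x, y) = D + 1 - b - x := by
  have hb := hC.nonneg
  have hd : l1 0 (x, y) ≤ D := by
    by_contra h
    have h1 := hC.le_zero hc.reach (P := (x, y)) (by omega)
    have := l1_nonneg (u, b) (x, y)
    omega
  have hle := hc.le_sub hC h0 hd
  have hxb : ¬(x = D - b ∧ y = b) := by
    rintro ⟨rfl, rfl⟩
    have h1 := hc.corner_eq
    have := l1_nonneg (u, y) (D - y, y)
    omega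
  have hrow : 0 ≤ y → y < b → 0 ≤ x → c (x, y) ≤ D - x - y := by
    intro h1 h2 h3
    have h4 : x + y ≤ D := by
      simp only [l1, abs_eq_max_neg, Prod.fst_zero, Prod.snd_zero] at hd
      omega
    have := hc.le_of_row_lt hC h1 h2 (D - x - y).toNat x h3 h0 (by omega)
    omega
  -- By the triangle inequality the cap `hle` exceeds the cone by at most `1`, and only on shortest
  -- paths from `0` to `(u, b)`; `hrow` removes the rows below `b`.
  simp only [l1, abs_eq_max_neg, Prod.fst_zero, Prod.snd_zero] at *
  omega

theorem not_globallyConfluent (hr : 2 ≤ r) (hf : 2 ≤ f) :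
    ¬GloballyConfluent squareFaces 0 (pulse squareFaces 0 r f) := by
  intro h
  obtain ⟨s, D, b, hC⟩ := exists_corner hr hf h
  obtain ⟨c, hc⟩ := hC.exists_frozen h.1
  have hb := hC.nonneg
  have hbD := hC.two_mul_le
  have hfD := hC.force_lt
  have hX0 : ((D - b, b) : ℤ × ℤ) ≠ 0 := mk_ne_zero (by omega)
  have hY0 : ((D - b - 1, b + 1) : ℤ × ℤ) ≠ 0 := mk_ne_zero (by omega)
  have hXc := hc.corner_eq
  have hYc := hc.next_eq
  -- On the neighbours of the hole this cone is at least `D - 1`, which is at least `f`.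
  have hupper : ∀ c', PulseReach r f c' → ∀ u, 0 ≤ u → u ≤ D - b →
      (∀ P, P ≠ 0 → c' P ≤ l1 (u, b) P + (D - u - b)) → ((u, b) : ℤ × ℤ) ≠ 0 →
      s (u, b) ≤ D - u - b := by
    intro c' hc' u hu huD hle hu0
    have := PulseReach.le_of_le hc' (hC.final c' hc') (u, b) (D - u - b) (by
      simp only [l1, abs_eq_max_neg, Prod.fst_zero, Prod.snd_zero]
      omega) hle hu0
    rwa [l1_self, zero_add] at this
  -- the leftmost face with excess in the row of the corner
  have hex : ∃ a : ℕ, ((a, b) : ℤ × ℤ) ≠ 0 ∧ (a : ℤ) < D - b ∧ c (a, b) = D + 1 - b - a := by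
    by_contra! hcon
    have := hupper c hc.reach (D - b) (by omega) le_rfl ?_ hX0
    · have := hC.pos
      omega
    · rintro ⟨x, y⟩ hP
      by_contra hlt
      obtain ⟨rfl, h1, -, h2, h3⟩ := hc.row_of_lt hC (by omega) le_rfl hP (not_le.1 hlt)
      have := hcon x.toNat
      rw [Int.toNat_of_nonneg h1] at this
      exact this hP h2 h3
  classical
  obtain ⟨ha0, haD, hac⟩ := Nat.find_spec hex
  have hmin : ∀ x : ℤ, 0 ≤ x → x < Nat.find hex → ((x, b) : ℤ × ℤ) ≠ 0 →
      c (x, b) ≠ D + 1 - b - x := by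
    intro x hx hxa h0 hcx
    have := Nat.find_min hex (m := x.toNat) (by omega)
    rw [Int.toNat_of_nonneg hx] at this
    exact this ⟨h0, by omega, hcx⟩
  set a : ℤ := (Nat.find hex : ℤ) with ha
  have ha_nonneg : 0 ≤ a := Int.natCast_nonneg _
  clear_value a
  have hab : a ≠ 0 ∨ b ≠ 0 := by
    by_contra! h0
    exact ha0 (by rw [h0.1, h0.2]; rfl)
  have hrow0 : ∀ x : ℤ, a ≤ x → ((x, b) : ℤ × ℤ) ≠ 0 := fun x hx => mk_ne_zero (by omega)
  have hle : ∀ x y : ℤ, 0 ≤ x → 0 ≤ y → x + y ≤ D → ((x, y) : ℤ × ℤ) ≠ 0 →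
      c (x, y) ≤ D + 1 - x - y := by
    intro x y hx hy hxy h0
    have e : l1 0 (x, y) = x + y := by
      simp only [l1, abs_eq_max_neg, Prod.fst_zero, Prod.snd_zero]
      omega
    have := hc.le_sub hC h0 (by omega)
    omega
  -- Excess propagates to the right: values drop by at most `1` per face, while the cap drops by
  -- exactly `1`.
  have hrow : ∀ n : ℕ, a + n < D - b → c (a + n, b) = D + 1 - b - (a + n) := by
    intro n
    induction n with
    | zero => intro _; simpa using hac
    | succ n ih =>
      intro hn
      push_cast at hn ⊢
      have h1 := ih (by omega)
      have h2 := hc.le_add_one hC (hrow0 (a + n) (by omega)) (hrow0 (a + n + 1) (by omega))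
        (adj_right _ b) (by simp only [ne_eq, Prod.mk.injEq, not_and]; omega)
        (by simp only [ne_eq, Prod.mk.injEq, not_and]; omega)
      have h3 := hle (a + n + 1) b (by omega) hb (by omega) (hrow0 _ (by omega))
      rw [← add_assoc]
      omega
  have hrow' : ∀ x, a ≤ x → x < D - b → c (x, b) = D + 1 - b - x := by
    intro x hx hxD
    have := hrow (x - a).toNat (by omega)
    rwa [show a + ((x - a).toNat : ℤ) = x by omega] at this
  -- emptying the first face of the row into the upper left neighbour of the corner
  have hR1 : PulseReach r f (fire 0 (a, b) (D - b - 1, b + 1) c) := by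
    refine Relation.ReflTransGen.trans hc.reach
      (reachable_fire_row (D - b - 1 - a).toNat ?_ ?_ ?_ hY0 ?_)
    · intro i hi
      rw [hrow' _ (by omega) (by omega), hrow' _ (by omega) (by omega)]
      omega
    · rw [hrow' _ (by omega) (by omega), hYc]
      omega
    · rw [show a + ((D - b - 1 - a).toNat : ℤ) = D - b - 1 by omega]
      exact adj_up _ _
    · intro i hi
      exact ⟨by simp, hrow0 _ (by omega)⟩
  have hR1v : ∀ x, a < x → fire 0 (a, b) (D - b - 1, b + 1) c (x, b) = c (x, b) := fun x hx =>
    fire_apply_of_ne (by simp only [ne_eq, Prod.mk.injEq, not_and]; omega) (by simp) c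
  have hbar : ∀ x y : ℤ, ((x, y) : ℤ × ℤ) ≠ 0 →
      l1 (a + 1, b) (x, y) + (D - (a + 1) - b) < c (x, y) →
      y = b ∧ (x = a ∨ x = a + 1) ∧ x < D - b ∧ c (x, y) = D + 1 - b - x := by
    intro x y h0 hlt
    obtain ⟨rfl, h1, h2, h3, h4⟩ := hc.row_of_lt hC (by omega) (by omega) h0 hlt
    refine ⟨rfl, ?_, h3, h4⟩
    by_contra hxa
    exact hmin x h1 (by omega) h0 h4
  -- Here `(a, b)` is the inner face itself, so the single push to `Y` already bounds `s` at the
  -- corner by `0`.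
  by_cases hlast : a + 1 = D - b
  · have := hupper _ hR1 (a + 1) (by omega) (by omega) ?_ (hrow0 _ (by omega))
    · have := hC.pos
      rw [← hlast] at this
      omega
    · rintro ⟨x, y⟩ hP
      by_contra hlt
      rw [not_le] at hlt
      have h0 := l1_nonneg (a + 1, b) (x, y)
      simp only [fire, hP, if_false, Prod.mk.injEq] at hlt
      split_ifs at hlt with h1 h2
      · obtain ⟨rfl, rfl⟩ := h1
        simp only [l1, abs_eq_max_neg] at hlt
        omega
      · obtain ⟨rfl, rfl⟩ := h2
        simp only [l1, abs_eq_max_neg] at hlt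
        omega
      · have := hbar x y hP hlt
        omega
  · have hu0 := hrow0 (a + 1) (by omega)
    -- first order: the next face of the row is emptied into the corner
    have hR2 : PulseReach r f
        (fire 0 (a + 1, b) (D - b, b) (fire 0 (a, b) (D - b - 1, b + 1) c)) := by
      refine Relation.ReflTransGen.trans hR1
        (reachable_fire_row (D - b - 1 - (a + 1)).toNat ?_ ?_ ?_ hX0 ?_)
      · intro i hi
        rw [hR1v _ (by omega), hR1v _ (by omega), hrow' _ (by omega) (by omega),
          hrow' _ (by omega) (by omega)]
        omega
      · rw [hR1v _ (by omega), hR1v _ (by omega), hrow' _ (by omega) (by omega), hXc]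
        omega
      · rw [show a + 1 + ((D - b - 1 - (a + 1)).toNat : ℤ) = D - b - 1 by omega]
        simpa using adj_right (D - b - 1) b
      · intro i hi
        exact ⟨by simp only [ne_eq, Prod.mk.injEq, not_and]; omega, hrow0 _ (by omega)⟩
    -- Only `(a, b)` and `(a + 1, b)` could violate the cone at `(a + 1, b)`, each by one unit, and
    -- both have lost one.
    have hup := hupper _ hR2 (a + 1) (by omega) (by omega) (by
      rintro ⟨x, y⟩ hP
      by_contra hlt
      rw [not_le] at hlt
      have h0 := l1_nonneg (a + 1, b) (x, y)
      by_cases e1 : ((x, y) : ℤ × ℤ) = (D - b, b)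
      · rw [e1, fire_apply_right hX0 (by simp only [ne_eq, Prod.mk.injEq, not_and]; omega),
          fire_apply_of_ne (by simp only [ne_eq, Prod.mk.injEq, not_and]; omega) (by simp),
          hXc] at hlt
        simp only [l1, abs_eq_max_neg] at hlt
        omega
      by_cases e2 : ((x, y) : ℤ × ℤ) = (D - b - 1, b + 1)
      · rw [e2, fire_apply_of_ne (by simp) (by simp), fire_apply_right hY0 (by simp),
          hYc] at hlt
        simp only [l1, abs_eq_max_neg] at hlt
        omega
      simp only [fire, hP, if_false, if_neg e1, if_neg e2] at hlt
      simp only [Prod.mk.injEq] at hlt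
      have := hbar x y hP (by split_ifs at hlt <;> omega)
      simp only [l1, abs_eq_max_neg] at hlt
      split_ifs at hlt <;> omega) hu0
    -- second order: the row of the corner loses only its first face
    have hR3 : PulseReach r f (fire 0 (a, b) (D - b, b) c) := by
      refine Relation.ReflTransGen.trans hc.reach
        (reachable_fire_row (D - b - 1 - a).toNat ?_ ?_ ?_ hX0 ?_)
      · intro i hi
        rw [hrow' _ (by omega) (by omega), hrow' _ (by omega) (by omega)]
        omega
      · rw [hrow' _ (by omega) (by omega), hXc]
        omega
      · rw [show a + ((D - b - 1 - a).toNat : ℤ) = D - b - 1 by omega]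
        simpa using adj_right (D - b - 1) b
      · intro i hi
        exact ⟨by simp only [ne_eq, Prod.mk.injEq, not_and]; omega, hrow0 _ (by omega)⟩
    have hR3v : ∀ x, fire 0 (a, b) (D - b, b) c (x, b + 1) = c (x, b + 1) := fun x =>
      fire_apply_of_ne (by simp) (by simp) c
    have hup0 : ∀ x : ℤ, ((x, b + 1) : ℤ × ℤ) ≠ 0 := fun x => mk_ne_zero (by omega)
    -- The row above is also forced to its cap, since it is at most `1` below the full row of the
    -- corner.
    have hup' : ∀ x, a ≤ x → x < D - b - 1 → c (x, b + 1) = D - b - x := by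
      intro x hx hxD
      have h1 := hrow' x hx (by omega)
      have h2 := hc.le_add_one hC (hrow0 x hx) (hup0 x) (adj_up x b) (by simp)
        (by simp only [ne_eq, Prod.mk.injEq, not_and]; omega)
      have h3 := hle x (b + 1) (by omega) (by omega) (by omega) (hup0 x)
      omega
    have hR4 : PulseReach r f
        (fire 0 (a, b + 1) (D - b - 1, b + 1) (fire 0 (a, b) (D - b, b) c)) := by
      refine Relation.ReflTransGen.trans hR3
        (reachable_fire_row (D - b - 2 - a).toNat ?_ ?_ ?_ hY0 ?_)
      · intro i hi
        rw [hR3v, hR3v, hup' _ (by omega) (by omega), hup' _ (by omega) (by omega)]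
        omega
      · rw [hR3v, hR3v, hup' _ (by omega) (by omega), hYc]
        omega
      · rw [show a + ((D - b - 2 - a).toNat : ℤ) = D - b - 2 by omega]
        have := adj_right (D - b - 2) (b + 1)
        rwa [show D - b - 2 + 1 = D - b - 1 by ring] at this
      · intro i hi
        exact ⟨by simp only [ne_eq, Prod.mk.injEq, not_and]; omega, hup0 _⟩
    -- The downward cone with apex value `c (a + 1, b) = D - b - a` lies below `c` except possibly
    -- at the hole and the blocked faces. A path through the hole restarts at height at least `f`;
    -- beyond a blocked face the cone is already `0`.
    have hlow : ∀ n : ℕ, ∀ P : ℤ × ℤ, P ≠ 0 → P ≠ (D - b, b) → P ≠ (D - b - 1, b + 1) →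
        l1 (a + 1, b) P = n → D - b - a - n ≤ c P := by
      have hu := hrow' (a + 1) (by omega) (by omega)
      intro n
      induction n with
      | zero =>
        intro P _ _ _ hn
        have : (a + 1, b) = P := by
          by_contra hne
          obtain ⟨R, -, hR⟩ := exists_adj_l1_eq hne
          have := l1_nonneg (a + 1, b) R
          omega
        rw [← this, hu]
        omega
      | succ n ih =>
        intro P hP hP1 hP2 hn
        push_cast at hn ⊢
        have hne : (a + 1, b) ≠ P := by
          rintro rfl
          rw [l1_self] at hn
          omega
        have hnn := reachable_nonneg (by omega) hc.reach P
        obtain ⟨R, hRP, hR⟩ := exists_adj_l1_eq hne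
        by_cases hR0 : R = 0
        · subst hR0
          have h1 := hc.le_apply P hRP
          have h2 := reachable_le (by omega) hc.reach (a + 1, b)
          omega
        by_cases hR1 : R = (D - b, b)
        · rw [hR1] at hR
          simp only [l1, abs_eq_max_neg] at hR hn
          omega
        by_cases hR2 : R = (D - b - 1, b + 1)
        · rw [hR2] at hR
          simp only [l1, abs_eq_max_neg] at hR hn
          omega
        have h1 := ih R hR0 hR1 hR2 (by omega)
        have h2 := hc.le_add_one hC hR0 hP hRP hP1 hP2
        omega
    -- The cone equals `1` at both blocked faces, exactly what each received; `(a, b)` and `(a, b +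
    -- 1)` had a unit to spare.
    have := PulseReach.ge_of_ge (by omega) hR4 (hC.final _ hR4) (a + 1, b) (D - b - a) (by
      rintro ⟨x, y⟩ hP
      by_cases e1 : ((x, y) : ℤ × ℤ) = (D - b, b)
      · rw [e1, fire_apply_of_ne (by simp) (by simp),
          fire_apply_right hX0 (by simp only [ne_eq, Prod.mk.injEq, not_and]; omega), hXc]
        simp only [l1, abs_eq_max_neg]
        omega
      by_cases e2 : ((x, y) : ℤ × ℤ) = (D - b - 1, b + 1)
      · rw [e2, fire_apply_right hY0 (by simp only [ne_eq, Prod.mk.injEq, not_and]; omega),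
          fire_apply_of_ne (by simp) (by simp), hYc]
        simp only [l1, abs_eq_max_neg]
        omega
      by_cases e3 : ((x, y) : ℤ × ℤ) = (a, b)
      · rw [e3, fire_apply_of_ne (by simp) (by simp), fire_apply_left ha0, hac]
        simp only [l1, abs_eq_max_neg]
        omega
      by_cases e4 : ((x, y) : ℤ × ℤ) = (a, b + 1)
      · rw [e4, fire_apply_left (hup0 a), hR3v, hup' a le_rfl (by omega)]
        simp only [l1, abs_eq_max_neg]
        omega
      rw [fire_apply_of_ne e4 e2, fire_apply_of_ne e3 e1]
      have h0 := l1_nonneg (a + 1, b) (x, y)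
      have := hlow (l1 (a + 1, b) (x, y)).toNat (x, y) hP e1 e2 (by omega)
      omega) hu0
    rw [l1_self] at this
    omega

end FrozenPulse

end FlowFiring

/-! ### Reduction to the hole at the origin and nonnegative force. -/

open FlowFiring in
theorem mainTheorem1 (hole : ℤ × ℤ) (r : ℕ) (hr : 0 < r) (f : ℤ) :
    FlowFiring.GloballyConfluent FlowFiring.squareFaces hole
        (FlowFiring.pulse FlowFiring.squareFaces hole r f) ↔
      (|f| ≤ 1 ∨ r ≤ 1) := by
  have htrans : GloballyConfluent squareFaces hole (pulse squareFaces hole r f) ↔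
      GloballyConfluent squareFaces 0 (pulse squareFaces 0 r f) := by
    constructor <;> intro h
    · exact globallyConfluent_pulse_translate hole 0 r f (by rwa [zero_add])
    · exact globallyConfluent_pulse_translate (-hole) hole r f (by rwa [add_neg_cancel])
  have habs : GloballyConfluent squareFaces 0 (pulse squareFaces 0 r f) ↔
      GloballyConfluent squareFaces 0 (pulse squareFaces 0 r |f|) := by
    rcases abs_choice f with h | h <;> rw [h]
    exact (globallyConfluent_pulse_neg_iff 0 r f).symm
  rw [htrans, habs]
  constructor
  · intro h
    by_contra! hcon
    exact not_globallyConfluent (by omega) (by omega) h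
  · rintro (h | h)
    · exact GloballyConfluent.of_stable (stable_pulse hr (abs_nonneg f) h)
    · obtain rfl : r = 1 := by omega
      exact globallyConfluent_pulse_one (abs_nonneg f)
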